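/- Let $(\Omega,\mathcal F,\mu)$ be a complete $\sigma$-finite measure space and, for every $\omega\in\Omega$, let $A_\omega\colon\mathbb R\to 2^{\mathbb R}$ be maximally monotone, that is, monotone with no monotone operator having a strictly larger graph. Set $\mathcal H=L^2(\Omega,\mathcal F,\mu;\mathbb R)$ and define $$A\colon\mathcal H\to 2^{\mathcal H}\colon x\mapsto\{x^*\in\mathcal H : x^*(\omega)\in A_\omega(x(\omega))\ \text{for } \mu\text{-almost every } \omega\in\Omega\}.$$ For an operator $B$, write $J_B=(\mathrm{Id}+B)^{-1}$ for its resolvent (each $J_{A_\omega}$ is a single-valued function from $\mathbb R$ to $\mathbb R$) and $\operatorname{dom}B=\{x : Bx\neq\varnothing\}$. Let $\Gamma_0(\mathcal H)$ be the set of lower semicontinuous convex functions $f\colon\mathcal H\to\left]-\infty,+\infty\right]$ that are not identically $+\infty$, and let $\partial f(x)=\{x^*\in\mathcal H : \langle y-x,x^*\rangle+f(x)\le f(y)\ \text{for all } y\in\mathcal H\}$. Then the following are equivalent: 1. $A$ is maximally monotone. 2. There exists $f\in\Gamma_0(\mathcal H)$ such that $A=\partial f$. 3. $\operatorname{dom}A\neq\varnothing$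 and, for every $\mathsf x\in\mathbb R$, the function $\Omega\to\mathbb R\colon\omega\mapsto J_{A_\omega}\mathsf x$ is $\mathcal F$-measurable. -/

import Mathlib

open MeasureTheory

namespace MonotoneOperator

/-- The domain of a set-valued operator `A : H → 2^H`. -/
def dom {H : Type*} (A : H → Set H) : Set H :=
  {x | (A x).Nonempty}

/-- The graph of a set-valued operator. -/
def graph {H : Type*} (A : H → Set H) : Set (H × H) :=
  {z | z.2 ∈ A z.1}

section Hilbert

variable {H : Type*} [NormedAddCommGroup H] [InnerProductSpace ℝ H]

/-- Monotone set-valued operators. -/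
def IsMonotone (A : H → Set H) : Prop :=
  ∀ x y, ∀ x' ∈ A x, ∀ y' ∈ A y, 0 ≤ inner ℝ (x - y) (x' - y')

/-- Maximally monotone operators: monotone, and no monotone operator has a strictly larger
graph. -/
def IsMaximallyMonotone (A : H → Set H) : Prop :=
  IsMonotone A ∧
    ¬ ∃ B : H → Set H, IsMonotone B ∧ graph A ⊆ graph B ∧ graph B ≠ graph A

/-- The class `Γ₀(H)` of lower semicontinuous convex functions `f : H → ]-∞, +∞]` with
nonempty domain. Convexity is convexity of the epigraph. -/
structure IsGammaZero (f : H → EReal) : Prop where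
  ne_bot : ∀ x, f x ≠ ⊥
  lowerSemicontinuous : LowerSemicontinuous f
  convex_epigraph : Convex ℝ {p : H × ℝ | f p.1 ≤ (p.2 : EReal)}
  dom_nonempty : {x | f x < ⊤}.Nonempty

/-- The subdifferential of an extended real-valued function. -/
def subdifferential (f : H → EReal) : H → Set H :=
  fun x => {x' | ∀ y, ((inner ℝ (y - x) x' : ℝ) : EReal) + f x ≤ f y}

end Hilbert

/-- The resolvent `J_A = (Id + A)⁻¹`, as a set-valued operator: `p ∈ J_A x` if and only if
`x ∈ p + A p`. -/
def resolvent {H : Type*} [AddCommGroup H] (A : H → Set H) : H → Set H :=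
  fun x => {p | x - p ∈ A p}

open Classical in
/-- The value at `x` of the resolvent `J_A`, where `J_A x` is a singleton (for maximally monotone
operators on `ℝ` this is always so, see `resolvent_eq_singleton`). The value is `0`, by
convention, where `J_A x` is empty. -/
noncomputable def resolventMap {H : Type*} [AddCommGroup H] (A : H → Set H) (x : H) : H :=
  if h : (resolvent A x).Nonempty then h.choose else 0

/-- The resolvent of a maximally monotone operator on the real line is everywhere defined and
single-valued, so that `resolventMap` is the resolvent as a function. -/
theorem resolvent_eq_singleton {A : ℝ → Set ℝ} (hA : IsMaximallyMonotone A) (x : ℝ) :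
    resolvent A x = {resolventMap A x} := by
  obtain ⟨hmon, hmax⟩ := hA
  have mono : ∀ u v u' v', u' ∈ A u → v' ∈ A v → 0 ≤ (u - v) * (u' - v') := by
    intro u v u' v' hu hv
    have := hmon u v u' hu v' hv
    simp only [RCLike.inner_apply, conj_trivial] at this
    linarith
  have hex : (resolvent A x).Nonempty := by
    obtain ⟨p, hp⟩ : ∃ p : ℝ, ∀ u, ∀ v ∈ A u, min u (x - v) ≤ p ∧ p ≤ max u (x - v) := by
      have key : ∀ u, ∀ v ∈ A u, ∀ s, ∀ t ∈ A s, min u (x - v) ≤ max s (x - t) := by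
        intro u v hv s t ht
        by_contra! hlt
        rw [max_lt_iff, lt_min_iff, lt_min_iff] at hlt
        obtain ⟨⟨h1, h2⟩, h3, h4⟩ := hlt
        nlinarith [mono u s v t hv ht, mul_pos (sub_pos.2 h1) (sub_pos.2 h4)]
      by_cases hne : ∃ u, (A u).Nonempty
      · obtain ⟨s, t, ht⟩ := hne
        refine ⟨sSup {m | ∃ u, ∃ v ∈ A u, m = min u (x - v)}, fun u v hv => ⟨?_, ?_⟩⟩
        · refine le_csSup ⟨max s (x - t), ?_⟩ ⟨u, v, hv, rfl⟩
          rintro m ⟨a, b, hb, rfl⟩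
          exact key a b hb s t ht
        · refine csSup_le ⟨_, s, t, ht, rfl⟩ ?_
          rintro m ⟨a, b, hb, rfl⟩
          exact key a b hb u v hv
      · exact ⟨0, fun u v hv => (hne ⟨u, v, hv⟩).elim⟩
    have hpos : ∀ u, ∀ v ∈ A u, 0 ≤ (u - p) * (v - (x - p)) := by
      intro u v hv
      obtain ⟨h1, h2⟩ := hp u v hv
      rcases le_total u (x - v) with h | h
      · rw [min_eq_left h] at h1
        rw [max_eq_right h] at h2
        nlinarith
      · rw [min_eq_right h] at h1
        rw [max_eq_left h] at h2
        nlinarith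
    refine ⟨p, ?_⟩
    by_contra hnot
    refine hmax ⟨fun u => {v | v ∈ A u ∨ (u = p ∧ v = x - p)}, ?_, ?_, ?_⟩
    · intro u v u' hu v' hv
      suffices 0 ≤ (u - v) * (u' - v') by
        simp only [RCLike.inner_apply, conj_trivial]
        linarith
      rcases hu with hu | ⟨rfl, rfl⟩ <;> rcases hv with hv | ⟨rfl, rfl⟩
      · exact mono _ _ _ _ hu hv
      · exact hpos _ _ hu
      · nlinarith [hpos _ _ hv]
      · simp
    · exact fun z hz => Or.inl hz
    · intro heq
      have : (p, x - p) ∈ graph A := by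
        rw [← heq]
        exact Or.inr ⟨rfl, rfl⟩
      exact hnot this
  have hmem : resolventMap A x ∈ resolvent A x := by
    unfold resolventMap
    rw [dif_pos hex]
    exact hex.choose_spec
  refine Set.eq_singleton_iff_unique_mem.2 ⟨hmem, fun q hq => ?_⟩
  have := mono _ _ _ _ hq hmem
  nlinarith [sq_nonneg (q - resolventMap A x)]

/-- The operator on `L²(Ω, μ; ℝ)` induced by a family of operators on `ℝ`. -/
def inducedOperator {Ω : Type*} [MeasurableSpace Ω] (μ : Measure Ω) (A : Ω → ℝ → Set ℝ) :
    Lp ℝ 2 μ → Set (Lp ℝ 2 μ) :=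
  fun x => {x' | ∀ᵐ ω ∂μ, x' ω ∈ A ω (x ω)}

end MonotoneOperator

/-! The equivalence of 1 and 2 rests on the order of `ℝ`: finitely many points of a monotone graph
in `ℝ × ℝ` are subgradients of a single function (`exists_forall_sub_mul_le_sub`). Integrating the
resulting chain inequalities makes the induced operator cyclically monotone, so Rockafellar's
antiderivative has a subdifferential containing it, and maximality forces equality. The converse is
Moreau's theorem, via proximal points.

For 1 → 3, the order of `L²` replaces the general Minty theorem: `J_A x` is the lattice supremum of
all `u ⊓ (x - v)` with `v ∈ A u`. It agrees a.e. with `ω ↦ J_{A_ω}(x(ω))`, which yields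
measurability. For 3 → 1, nonexpansiveness of the `J_{A_ω}` makes this same function measurable and
square integrable, so the resolvent is nonempty everywhere and `A` is maximal. -/

namespace MonotoneOperator

open Filter Topology

/-! ### Maximal monotonicity and Moreau's theorem in Hilbert spaces. -/

section Hilbert

variable {H : Type*} [NormedAddCommGroup H] [InnerProductSpace ℝ H]

/-- A maximally monotone operator contains every point monotonically related to its graph. -/
theorem IsMaximallyMonotone.mem_of_forall_inner_nonneg {A : H → Set H}
    (hA : IsMaximallyMonotone A) {p p' : H}
    (h : ∀ u, ∀ v ∈ A u, 0 ≤ inner ℝ (u - p) (v - p')) : p' ∈ A p := by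
  by_contra hnot
  refine hA.2 ⟨fun u => {v | v ∈ A u ∨ (u = p ∧ v = p')}, ?_, fun z hz => Or.inl hz, ?_⟩
  · rintro u v u' (hu | ⟨rfl, rfl⟩) v' (hv | ⟨rfl, rfl⟩)
    · exact hA.1 _ _ _ hu _ hv
    · exact h _ _ hu
    · have := h _ _ hv
      rwa [← neg_sub, ← neg_sub u' v', inner_neg_neg] at this
    · simp
  · intro heq
    have : (p, p') ∈ graph A := by
      rw [← heq]
      exact Or.inr ⟨rfl, rfl⟩
    exact hnot this

theorem IsMaximallyMonotone.eq_of_subset {A B : H → Set H} (hA : IsMaximallyMonotone A)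
    (hB : IsMonotone B) (h : ∀ x, A x ⊆ B x) : A = B := by
  funext x
  refine (h x).antisymm fun x' hx' => hA.mem_of_forall_inner_nonneg fun u v hv => ?_
  exact hB _ _ _ (h u hv) _ hx'

theorem IsMaximallyMonotone.dom_nonempty {A : H → Set H} (hA : IsMaximallyMonotone A) :
    (dom A).Nonempty := by
  by_contra hne
  have h : ∀ u, ∀ v ∈ A u, 0 ≤ inner ℝ (u - 0) (v - 0) := fun u v hv => (hne ⟨u, v, hv⟩).elim
  exact hne ⟨0, 0, hA.mem_of_forall_inner_nonneg h⟩

/-- The elementary half of Minty's theorem. -/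
theorem isMaximallyMonotone_of_resolvent_nonempty {A : H → Set H} (hA : IsMonotone A)
    (h : ∀ x, (resolvent A x).Nonempty) : IsMaximallyMonotone A := by
  refine ⟨hA, ?_⟩
  rintro ⟨B, hB, hAB, hne⟩
  refine hne (Set.Subset.antisymm ?_ hAB)
  rintro ⟨u, v⟩ huv
  -- Comparing `(u, v)` with `(p, u + v - p)` in `B` gives `-‖u - p‖² ≥ 0`.
  obtain ⟨p, hp⟩ := h (u + v)
  have hpA : u + v - p ∈ A p := hp
  have hpB : u + v - p ∈ B p := hAB (show (p, u + v - p) ∈ graph A from hpA)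
  have h1 := hB u p v huv _ hpB
  have h2 : v - (u + v - p) = -(u - p) := by abel
  rw [h2, inner_neg_right, real_inner_self_eq_norm_sq] at h1
  have h3 : ‖u - p‖ = 0 := by nlinarith [norm_nonneg (u - p)]
  have h4 : u = p := sub_eq_zero.1 (norm_eq_zero.1 h3)
  subst h4
  simpa [graph] using hpA

theorem IsGammaZero.exists_real_of_mem_subdifferential {f : H → EReal} (hf : IsGammaZero f)
    {x x' : H} (hx : x' ∈ subdifferential f x) : ∃ r : ℝ, f x = r := by
  obtain ⟨z, hz⟩ := hf.dom_nonempty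
  have hz' : f z < ⊤ := hz
  have h := (hx z).trans_lt hz'
  have htop : f x ≠ ⊤ := by
    intro h'
    rw [h', EReal.coe_add_top] at h
    exact lt_irrefl _ h
  exact ⟨(f x).toReal, (EReal.coe_toReal htop (hf.ne_bot x)).symm⟩

theorem IsGammaZero.isMonotone_subdifferential {f : H → EReal} (hf : IsGammaZero f) :
    IsMonotone (subdifferential f) := by
  intro x y x' hx y' hy
  obtain ⟨r, hr⟩ := hf.exists_real_of_mem_subdifferential hx
  obtain ⟨s, hs⟩ := hf.exists_real_of_mem_subdifferential hy
  have h1 := hx y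
  have h2 := hy x
  rw [hr, hs] at h1 h2
  norm_cast at h1 h2
  have h3 : inner ℝ (y - x) x' = - inner ℝ (x - y) x' := by rw [← inner_neg_left, neg_sub]
  rw [inner_sub_right]
  linarith

theorem isClosed_real_epigraph {X : Type*} [TopologicalSpace X] {f : X → EReal}
    (hf : LowerSemicontinuous f) : IsClosed {p : X × ℝ | f p.1 ≤ (p.2 : EReal)} :=
  hf.isClosed_epigraph.preimage
    (continuous_fst.prodMk (continuous_coe_real_ereal.comp continuous_snd))

/-- A function in `Γ₀(H)` has a continuous affine minorant. -/
theorem IsGammaZero.exists_affine_minorant [CompleteSpace H] {f : H → EReal}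
    (hf : IsGammaZero f) :
    ∃ (v : H) (c : ℝ), ∀ y t, f y ≤ ((t : ℝ) : EReal) → inner ℝ v y + c ≤ t := by
  obtain ⟨z, hz⟩ := hf.dom_nonempty
  have hz' : f z < ⊤ := hz
  lift f z to ℝ using ⟨hz'.ne, hf.ne_bot z⟩ with a ha
  -- Separating a point directly below `(z, a)` from the epigraph makes the functional non-vertical:
  -- `l (0, 1) > 0`.
  have hnot : (z, a - 1) ∉ {p : H × ℝ | f p.1 ≤ (p.2 : EReal)} := by
    simp only [Set.mem_ofPred_eq, ← ha, not_le]
    exact_mod_cast sub_one_lt a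
  obtain ⟨l, u, hlu, hl⟩ := geometric_hahn_banach_point_closed hf.convex_epigraph
    (isClosed_real_epigraph hf.lowerSemicontinuous) hnot
  have hsplit : ∀ y t, l (y, t) = l (y, 0) + t * l (0, 1) := by
    intro y t
    have : ((y, t) : H × ℝ) = (y, 0) + t • (0, 1) := by simp
    rw [this, map_add, map_smul, smul_eq_mul]
  have hza := hl (z, a) (by simp [← ha])
  rw [hsplit] at hlu hza
  have hpos : 0 < l (0, 1) := by linarith
  set m : StrongDual ℝ H := l.comp (ContinuousLinearMap.inl ℝ H ℝ) with hm
  refine ⟨-(l (0, 1))⁻¹ • (InnerProductSpace.toDual ℝ H).symm m, (l (0, 1))⁻¹ * u,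
    fun y t hyt => ?_⟩
  have h1 := hl (y, t) hyt
  rw [hsplit] at h1
  have h2 : m y = l (y, 0) := by simp [hm]
  rw [inner_smul_left, InnerProductSpace.toDual_symm_apply, h2, map_neg, conj_trivial]
  rw [show -(l (0, 1))⁻¹ * l (y, 0) + (l (0, 1))⁻¹ * u = (u - l (y, 0)) / l (0, 1) by
    field_simp; ring, div_le_iff₀ hpos]
  linarith

/-- Existence of proximal points, in terms of the epigraph. -/
theorem exists_isMinOn_add_half_norm_sub_sq [CompleteSpace H] {E : Set (H × ℝ)}
    (hc : Convex ℝ E) (hcl : IsClosed E) (hne : E.Nonempty) (x : H) {v : H} {c : ℝ}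
    (hbd : ∀ q ∈ E, inner ℝ v q.1 + c ≤ q.2) :
    ∃ q ∈ E, IsMinOn (fun q : H × ℝ => q.2 + ‖q.1 - x‖ ^ 2 / 2) E q := by
  set g : H × ℝ → ℝ := fun q => q.2 + ‖q.1 - x‖ ^ 2 / 2 with hg
  have hlow : BddBelow (g '' E) := by
    -- Completing the square: `⟪v, w⟫ + ‖w‖² / 2 ≥ -‖v‖² / 2` with `w = q.1 - x`.
    refine ⟨inner ℝ v x + c - ‖v‖ ^ 2 / 2, ?_⟩
    rintro _ ⟨q, hq, rfl⟩
    have h1 := hbd q hq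
    have h2 : inner ℝ v q.1 = inner ℝ v x + inner ℝ v (q.1 - x) := by
      rw [← inner_add_right]; simp
    have h3 := neg_le_of_abs_le (abs_real_inner_le_norm v (q.1 - x))
    simp only [hg]
    nlinarith [sq_nonneg (‖v‖ - ‖q.1 - x‖)]
  set m := sInf (g '' E) with hm
  have hmle : ∀ q ∈ E, m ≤ g q := fun q hq => csInf_le hlow ⟨q, hq, rfl⟩
  have hseq : ∀ n : ℕ, ∃ q ∈ E, g q < m + 1 / ((n : ℝ) + 1) := by
    intro n
    obtain ⟨_, ⟨q, hq, rfl⟩, hlt⟩ := exists_lt_of_csInf_lt (hne.image g)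
      (show sInf (g '' E) < m + 1 / ((n : ℝ) + 1) by
        rw [← hm]; linarith [Nat.one_div_pos_of_nat (α := ℝ) (n := n)])
    exact ⟨q, hq, hlt⟩
  choose q hqE hq using hseq
  -- Strong convexity: the midpoint lies in `E`, and the parallelogram law turns near-minimality
  -- into closeness.
  have hpar : ∀ a ∈ E, ∀ b ∈ E, ‖a.1 - b.1‖ ^ 2 ≤ 4 * (g a - m) + 4 * (g b - m) := by
    intro a ha b hb
    have hmid := hmle _ (hc ha hb (by norm_num : (0 : ℝ) ≤ 1 / 2) (by norm_num : (0 : ℝ) ≤ 1 / 2)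
      (by norm_num))
    simp only [hg, Prod.snd_add, Prod.smul_snd, Prod.fst_add, Prod.smul_fst, smul_eq_mul]
      at hmid ⊢
    have e1 : (1 / 2 : ℝ) • a.1 + (1 / 2 : ℝ) • b.1 - x
        = (1 / 2 : ℝ) • ((a.1 - x) + (b.1 - x)) := by module
    have e2 : a.1 - b.1 = (a.1 - x) - (b.1 - x) := by abel
    rw [e1, norm_smul, mul_pow] at hmid
    have hp := parallelogram_law_with_norm ℝ (a.1 - x) (b.1 - x)
    rw [e2]
    norm_num at hmid
    nlinarith
  have hlim : Tendsto (fun n : ℕ => g (q n)) atTop (𝓝 m) := by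
    refine tendsto_of_tendsto_of_tendsto_of_le_of_le tendsto_const_nhds ?_
      (fun n => hmle _ (hqE n)) (fun n => (hq n).le)
    simpa using tendsto_one_div_add_atTop_nhds_zero_nat.const_add m
  have hcau : CauchySeq fun n => (q n).1 := by
    refine cauchySeq_of_le_tendsto_0 (fun N : ℕ => √(8 * (1 / ((N : ℝ) + 1)))) ?_ ?_
    · intro i j N hi hj
      rw [dist_eq_norm]
      refine Real.le_sqrt_of_sq_le ((hpar _ (hqE i) _ (hqE j)).trans ?_)
      have hi' := Nat.one_div_le_one_div (α := ℝ) hi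
      have hj' := Nat.one_div_le_one_div (α := ℝ) hj
      linarith [hq i, hq j]
    · have := (tendsto_one_div_add_atTop_nhds_zero_nat (𝕜 := ℝ)).const_mul 8
      simpa using this.sqrt
  obtain ⟨y, hy⟩ := cauchySeq_tendsto_of_complete hcau
  have hnorm : Tendsto (fun n => ‖(q n).1 - x‖ ^ 2 / 2) atTop (𝓝 (‖y - x‖ ^ 2 / 2)) :=
    (((hy.sub_const x).norm).pow 2).div_const 2
  have hsnd : Tendsto (fun n => (q n).2) atTop (𝓝 (m - ‖y - x‖ ^ 2 / 2)) := by
    refine (hlim.sub hnorm).congr fun n => ?_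
    simp [hg]
  refine ⟨(y, m - ‖y - x‖ ^ 2 / 2), ?_, fun a ha => ?_⟩
  · exact hcl.mem_of_tendsto (hy.prodMk_nhds hsnd) (Eventually.of_forall hqE)
  · change m - ‖y - x‖ ^ 2 / 2 + ‖y - x‖ ^ 2 / 2 ≤ g a
    linarith [hmle a ha]

/-- Moreau's theorem: subdifferentials of functions in `Γ₀(H)` are maximally monotone. -/
theorem IsGammaZero.isMaximallyMonotone_subdifferential [CompleteSpace H] {f : H → EReal}
    (hf : IsGammaZero f) : IsMaximallyMonotone (subdifferential f) := by
  refine isMaximallyMonotone_of_resolvent_nonempty hf.isMonotone_subdifferential fun x => ?_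
  obtain ⟨v, c, hvc⟩ := hf.exists_affine_minorant
  have hne : {p : H × ℝ | f p.1 ≤ (p.2 : EReal)}.Nonempty := by
    obtain ⟨z, hz⟩ := hf.dom_nonempty
    exact ⟨(z, (f z).toReal), EReal.le_coe_toReal (ne_of_lt hz)⟩
  obtain ⟨⟨p, τ⟩, hp, hmin⟩ := exists_isMinOn_add_half_norm_sub_sq hf.convex_epigraph
    (isClosed_real_epigraph hf.lowerSemicontinuous) hne x (fun q hq => hvc q.1 q.2 hq)
  have hp' : f p ≤ (τ : EReal) := hp
  refine ⟨p, fun y => ?_⟩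
  by_cases hy : f y = ⊤
  · simp [hy]
  obtain ⟨t, ht⟩ : ∃ t : ℝ, f y = t := ⟨_, (EReal.coe_toReal hy (hf.ne_bot y)).symm⟩
  have hyE : (y, t) ∈ {p : H × ℝ | f p.1 ≤ (p.2 : EReal)} := ht.le
  -- First-order optimality: compare `p` with `(1 - s) p + s y`, divide by `s`, then let `s → 0`.
  have key : ∀ s : ℝ, 0 < s → s ≤ 1 →
      0 ≤ (t - τ) + inner ℝ (p - x) (y - p) + s * (‖y - p‖ ^ 2 / 2) := by
    intro s hs0 hs1
    have hs := hmin (hf.convex_epigraph hp hyE (sub_nonneg.2 hs1) hs0.le (by ring))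
    simp only [Set.mem_ofPred_eq, Prod.snd_add, Prod.smul_snd, Prod.fst_add, Prod.smul_fst,
      smul_eq_mul] at hs
    have e1 : (1 - s) • p + s • y - x = (p - x) + s • (y - p) := by module
    rw [e1, norm_add_sq_real, inner_smul_right, norm_smul, mul_pow, Real.norm_eq_abs, sq_abs] at hs
    have : 0 ≤ s * ((t - τ) + inner ℝ (p - x) (y - p) + s * (‖y - p‖ ^ 2 / 2)) := by
      linarith
    exact nonneg_of_mul_nonneg_right this hs0
  have hlim : Tendsto (fun s : ℝ => (t - τ) + inner ℝ (p - x) (y - p) + s * (‖y - p‖ ^ 2 / 2))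
      (𝓝[>] 0) (𝓝 ((t - τ) + inner ℝ (p - x) (y - p) + 0 * (‖y - p‖ ^ 2 / 2))) :=
    ((continuous_const.add (continuous_id.mul continuous_const)).tendsto 0).mono_left
      nhdsWithin_le_nhds
  have hfin : 0 ≤ (t - τ) + inner ℝ (p - x) (y - p) + 0 * (‖y - p‖ ^ 2 / 2) := by
    refine ge_of_tendsto hlim ?_
    filter_upwards [Ioc_mem_nhdsGT (zero_lt_one' ℝ)] with s hs using key s hs.1 hs.2
  have e2 : inner ℝ (y - p) (x - p) = - inner ℝ (p - x) (y - p) := by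
    rw [← inner_neg_left, neg_sub, real_inner_comm]
  calc ((inner ℝ (y - p) (x - p) : ℝ) : EReal) + f p
      ≤ ((inner ℝ (y - p) (x - p) : ℝ) : EReal) + τ := by gcongr
    _ ≤ f y := by
      rw [ht]
      norm_cast
      linarith

/-! ### Rockafellar's antiderivative. -/

/-- `AntiderivativeMinorant A x₀ x₀' v c` holds if `x ↦ ⟪v, x⟫ + c` is one of the affine functions
`x ↦ ⟪x - xₙ, xₙ'⟫ + ⋯ + ⟪x₁ - x₀, x₀'⟫`, with `(xᵢ, xᵢ')` in the graph of `A`, of which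
Rockafellar's antiderivative is the supremum. -/
inductive AntiderivativeMinorant (A : H → Set H) (x₀ x₀' : H) : H → ℝ → Prop
  | base : AntiderivativeMinorant A x₀ x₀' x₀' (-inner ℝ x₀' x₀)
  | step {v : H} {c : ℝ} {y y' : H} : AntiderivativeMinorant A x₀ x₀' v c → y' ∈ A y →
      AntiderivativeMinorant A x₀ x₀' y' (inner ℝ v y + c - inner ℝ y' y)

/-- Rockafellar's antiderivative of a set-valued operator. -/
noncomputable def antiderivative (A : H → Set H) (x₀ x₀' : H) (x : H) : EReal :=
  ⨆ (a : H × ℝ) (_ : AntiderivativeMinorant A x₀ x₀' a.1 a.2), ((inner ℝ a.1 x + a.2 : ℝ) : EReal)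

theorem antiderivative_le_iff {A : H → Set H} {x₀ x₀' x : H} {r : EReal} :
    antiderivative A x₀ x₀' x ≤ r ↔ ∀ v c, AntiderivativeMinorant A x₀ x₀' v c →
      ((inner ℝ v x + c : ℝ) : EReal) ≤ r := by
  simp [antiderivative, iSup_le_iff]

theorem AntiderivativeMinorant.le_antiderivative {A : H → Set H} {x₀ x₀' v : H} {c : ℝ}
    (h : AntiderivativeMinorant A x₀ x₀' v c) (x : H) :
    ((inner ℝ v x + c : ℝ) : EReal) ≤ antiderivative A x₀ x₀' x :=
  antiderivative_le_iff.1 le_rfl v c h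

/-- The hypothesis is cyclic monotonicity for chains closing up at `x₀`. It serves only to keep the
supremum finite there. -/
theorem isGammaZero_antiderivative {A : H → Set H} {x₀ x₀' : H}
    (h : ∀ v c, AntiderivativeMinorant A x₀ x₀' v c → inner ℝ v x₀ + c ≤ 0) :
    IsGammaZero (antiderivative A x₀ x₀') where
  ne_bot x := by
    have := AntiderivativeMinorant.base.le_antiderivative (A := A) (x₀ := x₀) (x₀' := x₀') x
    exact ((EReal.bot_lt_coe _).trans_le this).ne'
  lowerSemicontinuous := by
    refine lowerSemicontinuous_biSup fun a _ => Continuous.lowerSemicontinuous ?_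
    exact continuous_coe_real_ereal.comp ((continuous_const.inner continuous_id).add
      continuous_const)
  convex_epigraph := by
    rintro ⟨x, s⟩ hx ⟨y, t⟩ hy a b ha hb hab
    simp only [Set.mem_ofPred_eq, antiderivative_le_iff, EReal.coe_le_coe_iff, Prod.fst_add,
      Prod.smul_fst, Prod.snd_add, Prod.smul_snd, smul_eq_mul] at hx hy ⊢
    intro v c hv
    have h1 := mul_le_mul_of_nonneg_left (hx v c hv) ha
    have h2 := mul_le_mul_of_nonneg_left (hy v c hv) hb
    rw [inner_add_right, inner_smul_right, inner_smul_right]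
    have h3 : a * c + b * c = c := by rw [← add_mul, hab, one_mul]
    linarith
  dom_nonempty := by
    refine ⟨x₀, (antiderivative_le_iff (r := ((0 : ℝ) : EReal))|>.2 fun v c hv => ?_).trans_lt
      (EReal.coe_lt_top 0)⟩
    exact EReal.coe_le_coe_iff.2 (h v c hv)

/-- Appending `(x, x')` to a chain gives a minorant whose value at `y` is the old value at `x` plus
`⟪y - x, x'⟫`; take the supremum over chains. -/
theorem subset_subdifferential_antiderivative (A : H → Set H) (x₀ x₀' x : H) :
    A x ⊆ subdifferential (antiderivative A x₀ x₀') x := by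
  intro x' hx' y
  rw [add_comm, ← EReal.le_sub_iff_add_le (Or.inl (EReal.coe_ne_bot _))
    (Or.inl (EReal.coe_ne_top _)), antiderivative_le_iff]
  intro v c hv
  rw [EReal.le_sub_iff_add_le (Or.inl (EReal.coe_ne_bot _)) (Or.inl (EReal.coe_ne_top _))]
  refine le_trans (le_of_eq ?_) ((hv.step hx').le_antiderivative y)
  rw [← EReal.coe_add, inner_sub_left, real_inner_comm x' y, real_inner_comm x' x]
  congr 1
  ring

end Hilbert

/-! ### Monotone operators on the real line. -/

/-- A finite monotone subset of `ℝ × ℝ` lies in the graph of the subdifferential of a finite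
function. -/
theorem exists_forall_sub_mul_le_sub {T : Set (ℝ × ℝ)} (hfin : T.Finite)
    (hT : ∀ p ∈ T, ∀ q ∈ T, 0 ≤ (p.1 - q.1) * (p.2 - q.2)) :
    ∃ g : ℝ → ℝ, ∀ p ∈ T, ∀ x, (x - p.1) * p.2 ≤ g x - g p.1 := by
  obtain ⟨m, hm⟩ := (hfin.image Prod.snd).bddBelow
  obtain ⟨M, hM⟩ := (hfin.image Prod.snd).bddAbove
  -- `g` integrates the largest slope found at or to the left of `t`. The lower bound `m` supplies a
  -- value left of all points without exceeding any slope.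
  set S : ℝ → Set ℝ := fun t => insert m (Prod.snd '' {p ∈ T | p.1 ≤ t}) with hS
  have hne : ∀ t, (S t).Nonempty := fun t => Set.insert_nonempty _ _
  have hbd : ∀ t, BddAbove (S t) := by
    intro t
    refine BddAbove.insert m ⟨M, ?_⟩
    rintro _ ⟨p, hp, rfl⟩
    exact hM ⟨p, hp.1, rfl⟩
  have hmono : Monotone fun t => sSup (S t) := by
    intro t t' htt'
    refine csSup_le_csSup (hbd t') (hne t) (Set.insert_subset_insert (Set.image_mono ?_))
    exact fun p hp => ⟨hp.1, hp.2.trans htt'⟩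
  have hint : ∀ a b, IntervalIntegrable (fun t => sSup (S t)) volume a b :=
    fun a b => hmono.intervalIntegrable
  refine ⟨fun x => ∫ t in (0 : ℝ)..x, sSup (S t), fun p hp x => ?_⟩
  rw [intervalIntegral.integral_interval_sub_left (hint _ _) (hint _ _)]
  rcases le_total p.1 x with h | h
  · have := intervalIntegral.integral_mono_on h (intervalIntegrable_const (c := p.2)) (hint _ _)
      (fun t ht => le_csSup (hbd t) (Set.mem_insert_of_mem m ⟨p, ⟨hp, ht.1⟩, rfl⟩))
    simpa using this
  -- The open interval matters: `q.2 ≤ p.2` needs `q.1 ≤ t < p.1` strictly, since `T` may contain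
  -- several slopes over `p.1`.
  · have := intervalIntegral.integral_mono_on_of_le_Ioo h (hint _ _)
      (intervalIntegrable_const (c := p.2)) (fun t ht => by
        refine csSup_le (hne t) ?_
        rintro _ (rfl | ⟨q, ⟨hq, hqt⟩, rfl⟩)
        · exact hm ⟨p, hp, rfl⟩
        · nlinarith [hT q hq p hp, ht.2])
    rw [intervalIntegral.integral_symm]
    simp only [intervalIntegral.integral_const, smul_eq_mul] at this
    linarith

theorem IsMonotone.mul_nonneg {A : ℝ → Set ℝ} (hA : IsMonotone A) {x y x' y' : ℝ}
    (hx : x' ∈ A x) (hy : y' ∈ A y) : 0 ≤ (x - y) * (x' - y') := by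
  have := hA _ _ _ hx _ hy
  simp only [RCLike.inner_apply, conj_trivial] at this
  linarith

theorem IsMaximallyMonotone.sub_resolventMap_mem {A : ℝ → Set ℝ} (hA : IsMaximallyMonotone A)
    (x : ℝ) : x - resolventMap A x ∈ A (resolventMap A x) := by
  have : resolventMap A x ∈ resolvent A x := by
    rw [resolvent_eq_singleton hA]
    exact rfl
  exact this

theorem IsMaximallyMonotone.eq_resolventMap {A : ℝ → Set ℝ} (hA : IsMaximallyMonotone A)
    {x p : ℝ} (h : x - p ∈ A p) : p = resolventMap A x := by
  have : p ∈ resolvent A x := h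
  rwa [resolvent_eq_singleton hA] at this

/-- With `a = J x - J y`, monotonicity reads `0 ≤ a * ((x - y) - a)`, hence `a² ≤ (x - y)²`. -/
theorem IsMaximallyMonotone.abs_resolventMap_sub_le {A : ℝ → Set ℝ}
    (hA : IsMaximallyMonotone A) (x y : ℝ) :
    |resolventMap A x - resolventMap A y| ≤ |x - y| := by
  have h := hA.1.mul_nonneg (hA.sub_resolventMap_mem x) (hA.sub_resolventMap_mem y)
  refine abs_le_of_sq_le_sq' ?_ (abs_nonneg _) |> abs_le.2
  rw [sq_abs]
  nlinarith [sq_nonneg ((x - resolventMap A x) - (y - resolventMap A y))]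

theorem IsMaximallyMonotone.continuous_resolventMap {A : ℝ → Set ℝ}
    (hA : IsMaximallyMonotone A) : Continuous (resolventMap A) := by
  refine (LipschitzWith.of_dist_le_mul (K := 1) fun x y => ?_).continuous
  simpa [Real.dist_eq] using hA.abs_resolventMap_sub_le x y

/-! ### Cyclic monotonicity of the induced operator on `L²`. -/

section L2

variable {Ω : Type*} [MeasurableSpace Ω] {μ : Measure Ω}

theorem inner_eq_integral_mul (f g : Lp ℝ 2 μ) : inner ℝ f g = ∫ ω, f ω * g ω ∂μ := by
  rw [L2.inner_def]
  simp [mul_comm]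

theorem integrable_mul (f g : Lp ℝ 2 μ) : Integrable (fun ω => f ω * g ω) μ := by
  simpa [mul_comm] using L2.integrable_inner (𝕜 := ℝ) f g

theorem inner_nonneg_of_ae {f g : Lp ℝ 2 μ} (h : ∀ᵐ ω ∂μ, 0 ≤ f ω * g ω) :
    0 ≤ inner ℝ f g := by
  rw [inner_eq_integral_mul]
  exact integral_nonneg_of_ae h

theorem inner_nonneg_of_nonneg {f g : Lp ℝ 2 μ} (hf : 0 ≤ f) (hg : 0 ≤ g) :
    0 ≤ inner ℝ f g := by
  refine inner_nonneg_of_ae ?_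
  filter_upwards [(Lp.coeFn_nonneg f).2 hf, (Lp.coeFn_nonneg g).2 hg] with ω h1 h2
  exact mul_nonneg h1 h2

theorem isMonotone_inducedOperator {A : Ω → ℝ → Set ℝ} (hA : ∀ ω, IsMonotone (A ω)) :
    IsMonotone (inducedOperator μ A) := by
  intro x y x' hx y' hy
  refine inner_nonneg_of_ae ?_
  filter_upwards [hx, hy, Lp.coeFn_sub x y, Lp.coeFn_sub x' y'] with ω h1 h2 h3 h4
  rw [h3, h4]
  exact (hA ω).mul_nonneg h1 h2

/-- A chain in `L²` is a.e. a chain in `graph (A ω)` through a finite set `T`, and the subgradient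
inequalities telescope along it. Since `g` is chosen separately for each `ω`, no measurability of
`g` in `ω` is needed. -/
theorem AntiderivativeMinorant.exists_integrable {A : Ω → ℝ → Set ℝ} {x₀ x₀' v : Lp ℝ 2 μ} {c : ℝ}
    (h : AntiderivativeMinorant (inducedOperator μ A) x₀ x₀' v c)
    (h₀ : x₀' ∈ inducedOperator μ A x₀) :
    ∃ d : Ω → ℝ, Integrable d μ ∧ c = ∫ ω, d ω ∂μ ∧ ∀ᵐ ω ∂μ, ∃ T : Set (ℝ × ℝ), T.Finite ∧
      T ⊆ graph (A ω) ∧ ∀ g : ℝ → ℝ, (∀ p ∈ T, ∀ x, (x - p.1) * p.2 ≤ g x - g p.1) →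
        ∀ x, v ω * x + d ω ≤ g x - g (x₀ ω) := by
  induction h with
  | base =>
    refine ⟨fun ω => -(x₀' ω * x₀ ω), (integrable_mul _ _).neg, ?_, ?_⟩
    · rw [integral_neg, inner_eq_integral_mul]
    · filter_upwards [h₀] with ω h
      refine ⟨{(x₀ ω, x₀' ω)}, Set.finite_singleton _, Set.singleton_subset_iff.2 h, ?_⟩
      intro g hg x
      have := hg _ rfl x
      simp only at this
      linarith
  | @step v c y y' _ hy ih =>
    obtain ⟨d, hd, rfl, hdT⟩ := ih
    have hvd : Integrable (fun ω => v ω * y ω + d ω) μ := (integrable_mul _ _).add hd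
    refine ⟨fun ω => v ω * y ω + d ω - y' ω * y ω, hvd.sub (integrable_mul _ _), ?_, ?_⟩
    · rw [integral_sub hvd (integrable_mul _ _),
        integral_add (integrable_mul _ _) hd, inner_eq_integral_mul, inner_eq_integral_mul]
    · filter_upwards [hdT, hy] with ω h1 h2
      obtain ⟨T, hT, hTA, hTg⟩ := h1
      refine ⟨insert (y ω, y' ω) T, hT.insert _, Set.insert_subset h2 hTA, ?_⟩
      intro g hg x
      have h3 := hg _ (Set.mem_insert _ _) x
      have h4 := hTg g (fun p hp => hg p (Set.mem_insert_of_mem _ hp)) (y ω)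
      simp only at h3
      linarith

/-- Induced operators are cyclically monotone. -/
theorem AntiderivativeMinorant.inner_add_nonpos {A : Ω → ℝ → Set ℝ} (hA : ∀ ω, IsMonotone (A ω))
    {x₀ x₀' v : Lp ℝ 2 μ} {c : ℝ} (h : AntiderivativeMinorant (inducedOperator μ A) x₀ x₀' v c)
    (h₀ : x₀' ∈ inducedOperator μ A x₀) : inner ℝ v x₀ + c ≤ 0 := by
  obtain ⟨d, hd, rfl, hdT⟩ := h.exists_integrable h₀
  rw [inner_eq_integral_mul, ← integral_add (integrable_mul _ _) hd]
  refine integral_nonpos_of_ae ?_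
  filter_upwards [hdT] with ω ⟨T, hT, hTA, hTg⟩
  obtain ⟨g, hg⟩ := exists_forall_sub_mul_le_sub hT fun p hp q hq =>
    (hA ω).mul_nonneg (hTA hp) (hTA hq)
  simpa using hTg g hg (x₀ ω)

/-! ### Lattice suprema in `L²` and existence of resolvents. -/

theorem norm_sq_add_norm_sub_sq_le {a c : Lp ℝ 2 μ} (ha : 0 ≤ a) (hac : a ≤ c) :
    ‖a‖ ^ 2 + ‖c - a‖ ^ 2 ≤ ‖c‖ ^ 2 := by
  have h := norm_add_sq_real a (c - a)
  rw [add_sub_cancel] at h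
  have := inner_nonneg_of_nonneg ha (sub_nonneg.2 hac)
  linarith

/-- The lattice `L²(μ; ℝ)` is conditionally complete. -/
theorem exists_isLUB_of_bddAbove {S : Set (Lp ℝ 2 μ)} (hne : S.Nonempty) (hS : BddAbove S) :
    ∃ p, IsLUB S p := by
  obtain ⟨b, hb⟩ := hne
  obtain ⟨y, hy⟩ := hS
  -- `D` is directed, and on it `w - b ≥ 0`, so `φ` is increasing and controls distances between
  -- comparable elements.
  set D : Set (Lp ℝ 2 μ) := {w ∈ supClosure S | b ≤ w} with hD
  have hDy : ∀ w ∈ D, w ≤ y := fun w hw => by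
    have hy' := hy
    rw [← upperBounds_supClosure] at hy'
    exact hy' hw.1
  have hDsup : ∀ w ∈ D, ∀ w' ∈ D, w ⊔ w' ∈ D := fun w hw w' hw' =>
    ⟨supClosed_supClosure hw.1 hw'.1, hw.2.trans le_sup_left⟩
  set φ : Lp ℝ 2 μ → ℝ := fun w => ‖w - b‖ ^ 2 with hφ
  have hφle : ∀ w ∈ D, ∀ w', w ≤ w' → φ w + ‖w' - w‖ ^ 2 ≤ φ w' := fun w hw w' hww' => by
    have := norm_sq_add_norm_sub_sq_le (sub_nonneg.2 hw.2) (sub_le_sub_right hww' b)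
    rwa [sub_sub_sub_cancel_right] at this
  have hbdd : BddAbove (φ '' D) := by
    refine ⟨φ y, ?_⟩
    rintro _ ⟨w, hw, rfl⟩
    exact (le_add_of_nonneg_right (sq_nonneg _)).trans (hφle w hw y (hDy w hw))
  have hbD : b ∈ D := ⟨subset_supClosure hb, le_rfl⟩
  set M := sSup (φ '' D) with hM
  have hle : ∀ w ∈ D, φ w ≤ M := fun w hw => le_csSup hbdd ⟨w, hw, rfl⟩
  have hseq : ∀ n : ℕ, ∃ w ∈ D, M - 1 / ((n : ℝ) + 1) < φ w := by
    intro n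
    obtain ⟨_, ⟨w, hw, rfl⟩, hlt⟩ := exists_lt_of_lt_csSup (Set.Nonempty.image φ ⟨b, hbD⟩)
      (show M - 1 / ((n : ℝ) + 1) < sSup (φ '' D) by
        rw [← hM]; linarith [Nat.one_div_pos_of_nat (α := ℝ) (n := n)])
    exact ⟨w, hw, hlt⟩
  choose w hwD hw using hseq
  -- As `φ (w n)` is almost maximal, joining any `u ∈ D` to `w n` hardly moves it.
  have hsup : ∀ n, ∀ u ∈ D, ‖w n ⊔ u - w n‖ ≤ √(1 / ((n : ℝ) + 1)) := by
    intro n u hu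
    refine Real.le_sqrt_of_sq_le ?_
    have h1 := hφle _ (hwD n) (w n ⊔ u) le_sup_left
    have h2 := hle _ (hDsup _ (hwD n) _ hu)
    linarith [hw n]
  have hzero : Tendsto (fun n : ℕ => √(1 / ((n : ℝ) + 1))) atTop (𝓝 0) := by
    simpa using (tendsto_one_div_add_atTop_nhds_zero_nat (𝕜 := ℝ)).sqrt
  have hcau : CauchySeq w := by
    refine cauchySeq_of_le_tendsto_0 (fun N : ℕ => 2 * √(1 / ((N : ℝ) + 1))) ?_
      (by simpa using hzero.const_mul 2)
    intro i j N hi hj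
    have e : w i - w j = (w j ⊔ w i - w j) - (w i ⊔ w j - w i) := by
      rw [sup_comm (w j)]; abel
    rw [dist_eq_norm, e]
    refine (norm_sub_le _ _).trans ?_
    have hi' := Real.sqrt_le_sqrt (Nat.one_div_le_one_div (α := ℝ) hi)
    have hj' := Real.sqrt_le_sqrt (Nat.one_div_le_one_div (α := ℝ) hj)
    linarith [hsup i _ (hwD j), hsup j _ (hwD i)]
  obtain ⟨p, hp⟩ := cauchySeq_tendsto_of_complete hcau
  have hDp : ∀ u ∈ D, u ≤ p := by
    intro u hu
    have h1 : Tendsto (fun n => w n ⊔ u - w n) atTop (𝓝 (p ⊔ u - p)) :=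
      (hp.sup_nhds tendsto_const_nhds).sub hp
    have h2 : Tendsto (fun n => w n ⊔ u - w n) atTop (𝓝 0) :=
      squeeze_zero_norm (fun n => hsup n u hu) hzero
    exact sup_eq_left.1 (sub_eq_zero.1 (tendsto_nhds_unique h1 h2))
  refine ⟨p, fun u hu => ?_, fun z hz => ?_⟩
  · refine le_sup_right.trans (hDp (b ⊔ u) ⟨?_, le_sup_left⟩)
    exact supClosed_supClosure (subset_supClosure hb) (subset_supClosure hu)
  · refine le_of_tendsto' hp fun n => ?_
    rw [← upperBounds_supClosure] at hz
    exact hz (hwD n).1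

/-- Failure at some `ω` would mean `s < u` and `v < t` there, against monotonicity of `A ω`. -/
theorem inf_le_sup_of_mem_inducedOperator {A : Ω → ℝ → Set ℝ} (hA : ∀ ω, IsMonotone (A ω))
    (x : Lp ℝ 2 μ) {u v s t : Lp ℝ 2 μ} (hv : v ∈ inducedOperator μ A u)
    (ht : t ∈ inducedOperator μ A s) : u ⊓ (x - v) ≤ s ⊔ (x - t) := by
  rw [← Lp.coeFn_le]
  filter_upwards [hv, ht, Lp.coeFn_inf u (x - v), Lp.coeFn_sup s (x - t), Lp.coeFn_sub x v,
    Lp.coeFn_sub x t] with ω h1 h2 h3 h4 h5 h6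
  rw [h3, h4, Pi.inf_apply, Pi.sup_apply, h5, h6, Pi.sub_apply, Pi.sub_apply]
  by_contra! hlt
  rw [max_lt_iff, lt_min_iff, lt_min_iff] at hlt
  obtain ⟨⟨g1, g2⟩, g3, g4⟩ := hlt
  nlinarith [(hA ω).mul_nonneg h1 h2, mul_pos (sub_pos.2 g1) (sub_pos.2 g4)]

/-- Minty's theorem for induced operators. -/
theorem resolvent_inducedOperator_nonempty {A : Ω → ℝ → Set ℝ} (hA : ∀ ω, IsMonotone (A ω))
    (hmax : IsMaximallyMonotone (inducedOperator μ A)) (x : Lp ℝ 2 μ) :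
    (resolvent (inducedOperator μ A) x).Nonempty := by
  obtain ⟨s, t, ht⟩ := hmax.dom_nonempty
  set S : Set (Lp ℝ 2 μ) := {w | ∃ u, ∃ v ∈ inducedOperator μ A u, w = u ⊓ (x - v)} with hS
  have hub : ∀ u, ∀ v ∈ inducedOperator μ A u, u ⊔ (x - v) ∈ upperBounds S := by
    rintro u v hv _ ⟨u', v', hv', rfl⟩
    exact inf_le_sup_of_mem_inducedOperator hA x hv' hv
  obtain ⟨p, hp⟩ := exists_isLUB_of_bddAbove (S := S) ⟨_, s, t, ht, rfl⟩ ⟨_, hub s t ht⟩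
  -- A.e., `p` lies between `u` and `x - v`, so `(u - p) * (v - (x - p)) ≥ 0`. The null set may
  -- depend on `(u, v)`; maximality is used only after integration.
  refine ⟨p, hmax.mem_of_forall_inner_nonneg fun u v hv => inner_nonneg_of_ae ?_⟩
  filter_upwards [(Lp.coeFn_le _ _).2 (hp.1 ⟨u, v, hv, rfl⟩), (Lp.coeFn_le _ _).2 (hp.2 (hub u v hv)),
    Lp.coeFn_inf u (x - v), Lp.coeFn_sup u (x - v), Lp.coeFn_sub x v, Lp.coeFn_sub x p,
    Lp.coeFn_sub u p, Lp.coeFn_sub v (x - p)] with ω h1 h2 h3 h4 h5 h6 h7 h8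
  rw [h3, Pi.inf_apply, h5, Pi.sub_apply] at h1
  rw [h4, Pi.sup_apply, h5, Pi.sub_apply] at h2
  rw [h7, h8, Pi.sub_apply, Pi.sub_apply, h6, Pi.sub_apply]
  rcases le_total (u ω) (x ω - v ω) with h | h
  · rw [min_eq_left h] at h1
    rw [max_eq_right h] at h2
    nlinarith
  · rw [min_eq_right h] at h1
    rw [max_eq_left h] at h2
    nlinarith

/-! ### Measurability of the pointwise resolvents. -/

theorem aemeasurable_resolventMap_comp {A : Ω → ℝ → Set ℝ} (hA : ∀ ω, IsMaximallyMonotone (A ω))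
    (hmax : IsMaximallyMonotone (inducedOperator μ A)) (x : Lp ℝ 2 μ) :
    AEMeasurable (fun ω => resolventMap (A ω) (x ω)) μ := by
  obtain ⟨p, hp⟩ := resolvent_inducedOperator_nonempty (fun ω => (hA ω).1) hmax x
  have hp' : x - p ∈ inducedOperator μ A p := hp
  refine (Lp.aestronglyMeasurable p).aemeasurable.congr ?_
  filter_upwards [hp', Lp.coeFn_sub x p] with ω h1 h2
  rw [h2] at h1
  exact (hA ω).eq_resolventMap h1

/-- Constants need not be in `L²`, so `x` is truncated to the spanning sets; at a.e. `ω` the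
truncations eventually equal `x`. -/
theorem aemeasurable_resolventMap [SigmaFinite μ] {A : Ω → ℝ → Set ℝ}
    (hA : ∀ ω, IsMaximallyMonotone (A ω))
    (hmax : IsMaximallyMonotone (inducedOperator μ A)) (x : ℝ) :
    AEMeasurable (fun ω => resolventMap (A ω) x) μ := by
  refine aemeasurable_of_tendsto_metrizable_ae' (f := fun n ω => resolventMap (A ω)
    ((indicatorConstLp 2 (measurableSet_spanningSets μ n)
      (measure_spanningSets_lt_top μ n).ne x : Lp ℝ 2 μ) ω))
    (fun n => aemeasurable_resolventMap_comp hA hmax _) ?_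
  have hae : ∀ᵐ ω ∂μ, ∀ n, ω ∈ spanningSets μ n → (indicatorConstLp 2
      (measurableSet_spanningSets μ n) (measure_spanningSets_lt_top μ n).ne x : Lp ℝ 2 μ) ω = x :=
    ae_all_iff.2 fun n => indicatorConstLp_coeFn_mem
  filter_upwards [hae] with ω hω
  refine tendsto_const_nhds.congr' ?_
  filter_upwards [eventually_mem_spanningSets μ ω] with n hn
  rw [hω n hn]

theorem resolvent_inducedOperator_nonempty_of_measurable {A : Ω → ℝ → Set ℝ}
    (hA : ∀ ω, IsMaximallyMonotone (A ω)) (hdom : (dom (inducedOperator μ A)).Nonempty)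
    (hmeas : ∀ x : ℝ, Measurable fun ω => resolventMap (A ω) x) (x : Lp ℝ 2 μ) :
    (resolvent (inducedOperator μ A) x).Nonempty := by
  obtain ⟨z, z', hz⟩ := hdom
  -- Carathéodory: continuity in `x` and measurability in `ω` give joint measurability.
  have hunc := measurable_uncurry_of_continuous_of_measurable
    (u := fun (x : ℝ) ω => resolventMap (A ω) x)
    (fun ω => (hA ω).continuous_resolventMap) hmeas
  have hp : AEStronglyMeasurable (fun ω => resolventMap (A ω) (x ω)) μ :=
    (hunc.comp ((Lp.stronglyMeasurable x).measurable.prodMk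
      measurable_id)).aestronglyMeasurable
  -- Since `z = J (z + z')` pointwise a.e., nonexpansiveness bounds `J x - z` by an `L²` function.
  have hbound : ∀ᵐ ω ∂μ, ‖resolventMap (A ω) (x ω) - z ω‖ ≤ ‖(x - (z + z') : Lp ℝ 2 μ) ω‖ := by
    filter_upwards [hz, Lp.coeFn_sub x (z + z'), Lp.coeFn_add z z'] with ω h1 h2 h3
    have h4 : z ω = resolventMap (A ω) (z ω + z' ω) :=
      (hA ω).eq_resolventMap (by simpa using h1)
    rw [h2, Pi.sub_apply, h3, Pi.add_apply, Real.norm_eq_abs, Real.norm_eq_abs]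
    nth_rw 1 [h4]
    exact (hA ω).abs_resolventMap_sub_le _ _
  have hmem : MemLp (fun ω => resolventMap (A ω) (x ω)) 2 μ := by
    have h1 : MemLp (fun ω => resolventMap (A ω) (x ω) - z ω) 2 μ :=
      (Lp.memLp (x - (z + z'))).mono (hp.sub (Lp.aestronglyMeasurable z)) hbound
    have h2 := h1.add (Lp.memLp z)
    refine (memLp_congr_ae (Eventually.of_forall fun ω => ?_)).1 h2
    simp
  refine ⟨hmem.toLp _, ?_⟩
  change ∀ᵐ ω ∂μ, _
  filter_upwards [hmem.coeFn_toLp, Lp.coeFn_sub x (hmem.toLp _)] with ω h1 h2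
  rw [h2, Pi.sub_apply, h1]
  exact (hA ω).sub_resolventMap_mem _

theorem inducedOperator_eq_subdifferential_antiderivative {A : Ω → ℝ → Set ℝ}
    (hA : ∀ ω, IsMonotone (A ω)) (hmax : IsMaximallyMonotone (inducedOperator μ A))
    {z z' : Lp ℝ 2 μ} (hz : z' ∈ inducedOperator μ A z) :
    IsGammaZero (antiderivative (inducedOperator μ A) z z') ∧
      inducedOperator μ A = subdifferential (antiderivative (inducedOperator μ A) z z') := by
  have hf : IsGammaZero (antiderivative (inducedOperator μ A) z z') :=
    isGammaZero_antiderivative fun v c h => h.inner_add_nonpos hA hz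
  exact ⟨hf, hmax.eq_of_subset hf.isMonotone_subdifferential
    (subset_subdifferential_antiderivative _ z z')⟩

end L2

end MonotoneOperator

theorem corollaryc {Ω : Type*} [MeasurableSpace Ω] (μ : MeasureTheory.Measure Ω)
    [μ.IsComplete] [MeasureTheory.SigmaFinite μ]
    (A : Ω → ℝ → Set ℝ) (hA : ∀ ω, MonotoneOperator.IsMaximallyMonotone (A ω)) :
    List.TFAE [
      MonotoneOperator.IsMaximallyMonotone (MonotoneOperator.inducedOperator μ A),
      ∃ f : MeasureTheory.Lp ℝ 2 μ → EReal, MonotoneOperator.IsGammaZero f ∧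
        MonotoneOperator.inducedOperator μ A = MonotoneOperator.subdifferential f,
      (MonotoneOperator.dom (MonotoneOperator.inducedOperator μ A)).Nonempty ∧
        ∀ x : ℝ, Measurable fun ω => MonotoneOperator.resolventMap (A ω) x] := by
  have hmon : ∀ ω, MonotoneOperator.IsMonotone (A ω) := fun ω => (hA ω).1
  tfae_have 1 → 2 := fun h => by
    obtain ⟨z, z', hz⟩ := h.dom_nonempty
    exact ⟨_, MonotoneOperator.inducedOperator_eq_subdifferential_antiderivative hmon h hz⟩
  tfae_have 2 → 1 := by
    rintro ⟨f, hf, hAf⟩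
    rw [hAf]
    exact hf.isMaximallyMonotone_subdifferential
  -- Completeness of `μ` upgrades a.e. measurability to measurability.
  tfae_have 1 → 3 := fun h => ⟨h.dom_nonempty, fun x =>
    aemeasurable_iff_measurable.1 (MonotoneOperator.aemeasurable_resolventMap hA h x)⟩
  tfae_have 3 → 1 := fun h => MonotoneOperator.isMaximallyMonotone_of_resolvent_nonempty
    (MonotoneOperator.isMonotone_inducedOperator hmon)
    (MonotoneOperator.resolvent_inducedOperator_nonempty_of_measurable hA h.1 h.2)
  tfae_finish
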